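/- Let $d \ge 2$ be an integer and let $\varepsilon > 0$. Every free action of $\mathbb{Z}^d$ on the circle $\mathbb{R}/\mathbb{Z}$ by diffeomorphisms of class $C^{1+1/d+\varepsilon}$ is minimal. Here a self-map of the circle is of class $C^r$ (with $r \ge 1$ real) if it has a lift $F : \mathbb{R} \to \mathbb{R}$ that is of class $C^k$, $k = \lfloor r \rfloor$, and for which there is a constant $C$ with $|F^{(k)}(x) - F^{(k)}(y)| \le C\,|x-y|^{r-k}$ for all $x, y \in \mathbb{R}$ (for $r = 1+\tau$ with $0 < \tau < 1$: the derivative is $\tau$-Hölder continuous). A diffeomorphism of class $C^r$ is a bijection that is of class $C^r$ together with its inverse; it is not assumed to preserve the orientation. The action is free if no nonzero element of $\mathbb{Z}^d$ has a fixed point, and minimal if every orbit is dense. -/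

import Mathlib

/-- A self-map `f` of the circle `ℝ/ℤ` is of class `C^r` (for a real number `r ≥ 1`) if it has
a lift `F : ℝ → ℝ` that is `k = ⌊r⌋` times continuously differentiable and whose `k`-th derivative
is Hölder continuous with exponent `r - k`. The derivatives of a lift are `1`-periodic, so this is
Hölder continuity on the circle, and for integer `r` the second condition holds automatically. For
`r = 1 + τ` with `0 < τ < 1` it says that `f` is `C^1` and `|f'(x) - f'(y)| ≤ C |x - y| ^ τ`. -/
def IsCircleMapOfClass (r : ℝ) (f : UnitAddCircle → UnitAddCircle) : Prop :=
  ∃ F : ℝ → ℝ, (∀ x : ℝ, ((F x : ℝ) : UnitAddCircle) = f (x : UnitAddCircle)) ∧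
    ContDiff ℝ (⌊r⌋₊ : ℕ) F ∧
    ∃ C : ℝ, ∀ x y : ℝ,
      |iteratedDeriv ⌊r⌋₊ F x - iteratedDeriv ⌊r⌋₊ F y| ≤ C * |x - y| ^ (r - (⌊r⌋₊ : ℝ))

/-- A diffeomorphism of class `C^r` of the circle: a bijection of class `C^r` whose inverse is
of class `C^r`. -/
def IsCircleDiffeoOfClass (r : ℝ) (f : UnitAddCircle ≃ UnitAddCircle) : Prop :=
  IsCircleMapOfClass r f ∧ IsCircleMapOfClass r f.symm

/-- An additive group acts freely if no nonzero element has a fixed point. -/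
def IsFreeAddAction (G X : Type*) [AddGroup G] [AddAction G X] : Prop :=
  ∀ (g : G) (x : X), g +ᵥ x = x → g = 0

/-! Translation numbers are invariant under conjugation, so lifts of elements of an abelian group
commute, and a degree-one monotone map `h` semiconjugates all of them to translations; freeness
makes the translation numbers of independent elements independent modulo `1`. The action is minimal
as soon as `h` is injective. Otherwise `h` is constant on some interval `[a, b]` with `b` maximal,
whose images under the monomials `v : ι → ℕ` in the generators overlap at most at endpoints modulo
`1`, hence have summable lengths `l v`.

A random monotone lattice path drawn by a Pólya urn is uniformly distributed on the points of
coordinate sum `n` at time `n`, so AM-GM and `1 < card ι * σ` bound the expected value of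
`∑ l v ^ σ` along it uniformly in `n`. This is the sum that controls the distortion of maps with
`σ`-Hölder derivative: along a path where it is bounded, an interval `[b, b + δ]` with `δ`
independent of the path keeps an image no longer than that of `[a, b]`. Prolonging such a path along
one axis, which `h` turns into an irrational rotation, brings the image of `b` just to the right of
`b`. The resulting element, composed with an integer translation, moves `b` to the right and maps
`[b, b + δ]` into itself, so its translation number is both positive and nonpositive. -/

open Set Filter Topology CircleDeg1Lift

theorem unitAddCircle_coe_eq_coe_iff {x y : ℝ} :
    (x : UnitAddCircle) = y ↔ ∃ m : ℤ, x = y + m := by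
  rw [← sub_eq_zero, ← AddCircle.coe_sub, AddCircle.coe_eq_zero_iff]
  simp only [zsmul_eq_mul, mul_one, eq_comm, sub_eq_iff_eq_add']

theorem exists_int_forall_eq_of_continuous {f : ℝ → ℝ} (hf : Continuous f)
    (h : ∀ x, ∃ m : ℤ, f x = m) : ∃ m : ℤ, ∀ x, f x = m := by
  choose m hm using h
  have hc : Continuous m := by
    rw [Int.isClosedEmbedding_coe_real.isInducing.continuous_iff]
    exact hf.congr hm
  exact ⟨m 0, fun x => by rw [hm, PreconnectedSpace.constant inferInstance hc]⟩

theorem exists_int_forall_eq_add_of_coe_eq {F G : ℝ → ℝ} (hF : Continuous F) (hG : Continuous G)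
    (h : ∀ x, (F x : UnitAddCircle) = G x) : ∃ m : ℤ, ∀ x, F x = G x + m := by
  simp only [← sub_eq_iff_eq_add']
  refine exists_int_forall_eq_of_continuous (hF.sub hG) fun x => ?_
  simpa only [Pi.sub_apply, sub_eq_iff_eq_add'] using unitAddCircle_coe_eq_coe_iff.1 (h x)

theorem sub_lt_one_of_continuous_of_forall_ne_int {f : ℝ → ℝ} (hf : Continuous f)
    (h : ∀ x, ∀ m : ℤ, f x ≠ m) (x y : ℝ) : f x - f y < 1 := by
  by_contra! hle
  obtain ⟨z, hz⟩ := mem_range_of_exists_le_of_exists_ge hf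
    ⟨y, Int.le_ceil (f y)⟩ ⟨x, by linarith [Int.ceil_lt_add_one (f y)]⟩
  exact h z _ hz

theorem lift_add_one_of_fixedPointFree {f : UnitAddCircle → UnitAddCircle} {F : ℝ → ℝ}
    (hF : Continuous F) (hlift : ∀ x : ℝ, (F x : UnitAddCircle) = f x)
    (hfix : ∀ x, f x ≠ x) (x : ℝ) : F (x + 1) = F x + 1 := by
  obtain ⟨k, hk⟩ := exists_int_forall_eq_add_of_coe_eq (F := fun x => F (x + 1)) (G := F)
    (by fun_prop) hF fun x => by simp [hlift]
  have hno : ∀ (y : ℝ) (m : ℤ), F y - y ≠ m := fun y m h => by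
    refine hfix y ?_
    rw [← hlift, unitAddCircle_coe_eq_coe_iff]
    exact ⟨m, by linarith⟩
  have hosc := sub_lt_one_of_continuous_of_forall_ne_int (hF.sub continuous_id) hno
  have hlt : |(k : ℝ) - 1| < 1 := by
    have h1 := hosc (x + 1) x
    have h2 := hosc x (x + 1)
    simp only [Pi.sub_apply, id, hk] at h1 h2
    exact abs_lt.2 ⟨by linarith, by linarith⟩
  have hk1 : k - 1 = 0 := Int.abs_lt_one_iff.1 (by exact_mod_cast hlt)
  rw [hk, sub_eq_zero.1 hk1, Int.cast_one]

theorem periodic_deriv_of_map_add_one {F : ℝ → ℝ} (h : ∀ x, F (x + 1) = F x + 1) :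
    Function.Periodic (deriv F) 1 := fun x => by
  rw [← deriv_comp_add_const]
  simp [h]

theorem exists_abs_deriv_sub_le_of_contDiff_two {F : ℝ → ℝ} (hF : ContDiff ℝ 2 F)
    (hadd : ∀ x, F (x + 1) = F x + 1) :
    ∃ C, 0 ≤ C ∧ ∀ x y, |deriv F x - deriv F y| ≤ C * |x - y| := by
  have hd : ContDiff ℝ 1 (deriv F) := ((contDiff_succ_iff_deriv (n := 1)).1 hF).2.2
  have hper : Function.Periodic (deriv (deriv F)) 1 := fun x => by
    rw [← deriv_comp_add_const]
    simp [periodic_deriv_of_map_add_one hadd _]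
  obtain ⟨M, hM⟩ := (hper.isBounded_of_continuous one_ne_zero
    (hd.continuous_deriv le_rfl)).exists_norm_le
  replace hM : ∀ x, ‖deriv (deriv F) x‖ ≤ M := fun x => hM _ (mem_range_self x)
  exact ⟨M, (norm_nonneg _).trans (hM 0), fun x y =>
    convex_univ.norm_image_sub_le_of_norm_deriv_le
      (fun z _ => hd.differentiable one_ne_zero z) (fun z _ => hM z) (mem_univ y) (mem_univ x)⟩

theorem exists_holder_deriv {F : ℝ → ℝ} {r : ℝ} (hr : 1 < r)
    (hF : ContDiff ℝ (⌊r⌋₊ : ℕ) F) (hadd : ∀ x, F (x + 1) = F x + 1)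
    (hC : ∃ C : ℝ, ∀ x y : ℝ,
      |iteratedDeriv ⌊r⌋₊ F x - iteratedDeriv ⌊r⌋₊ F y| ≤ C * |x - y| ^ (r - (⌊r⌋₊ : ℝ))) :
    ∃ C, 0 ≤ C ∧ ∀ x y, |deriv F x - deriv F y| ≤ C * |x - y| ^ min (r - 1) 1 := by
  rcases lt_or_ge r 2 with hr2 | hr2
  · have hfl : ⌊r⌋₊ = 1 := by
      rw [Nat.floor_eq_iff (by linarith)]
      norm_num [hr.le, hr2]
    obtain ⟨C, hC⟩ := hC
    rw [hfl, iteratedDeriv_one, Nat.cast_one] at hC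
    rw [min_eq_left (by linarith)]
    exact ⟨|C|, abs_nonneg C, fun x y => (hC x y).trans (by gcongr; exact le_abs_self C)⟩
  · have hfl : 2 ≤ ⌊r⌋₊ := Nat.le_floor (by exact_mod_cast hr2)
    rw [min_eq_right (by linarith)]
    simpa only [Real.rpow_one] using
      exists_abs_deriv_sub_le_of_contDiff_two (hF.of_le (by exact_mod_cast hfl)) hadd

theorem exists_one_le_mul_of_periodic_of_pos {g : ℝ → ℝ} (hg : Continuous g)
    (hper : Function.Periodic g 1) (hpos : ∀ x, 0 < g x) : ∃ M, 0 ≤ M ∧ ∀ x, 1 ≤ M * g x := by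
  have hper' : Function.Periodic (fun x => (g x)⁻¹) 1 := fun x => by simp only [hper x]
  obtain ⟨M, hM⟩ := (hper'.isBounded_of_continuous one_ne_zero
    (hg.inv₀ fun x => (hpos x).ne')).exists_norm_le
  replace hM : ∀ x, ‖(g x)⁻¹‖ ≤ M := fun x => hM _ (mem_range_self x)
  exact ⟨M, (norm_nonneg _).trans (hM 0), fun x =>
    (inv_le_iff_one_le_mul₀ (hpos x)).1 ((le_abs_self _).trans (hM x))⟩

/-- The map `F` increases the ratio `(c - b) / (b - a)` of the lengths of two adjacent intervals,
the right one not longer than the left one, at most by the factor `exp (K * (b - a) ^ σ)`. The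
inequality is cleared of denominators. -/
def RatioDistortionLE (F : ℝ → ℝ) (K σ : ℝ) : Prop :=
  ∀ ⦃a b c : ℝ⦄, a < b → b < c → c - b ≤ b - a → b - a ≤ 1 →
    (F c - F b) * (b - a) ≤ (c - b) * (F b - F a) * Real.exp (K * (b - a) ^ σ)

theorem RatioDistortionLE.mono {F : ℝ → ℝ} {K K' σ p : ℝ} (h : RatioDistortionLE F K p)
    (hF : Monotone F) (hK : 0 ≤ K) (hKK' : K ≤ K') (hσp : σ ≤ p) : RatioDistortionLE F K' σ := by
  intro a b c hab hbc hle h1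
  have hba : 0 < b - a := sub_pos.2 hab
  have : 0 ≤ c - b := (sub_pos.2 hbc).le
  have hFab : 0 ≤ F b - F a := sub_nonneg.2 (hF hab.le)
  refine (h hab hbc hle h1).trans ?_
  have hK' : 0 ≤ K' := hK.trans hKK'
  have hpow : (b - a) ^ p ≤ (b - a) ^ σ := Real.rpow_le_rpow_of_exponent_ge hba h1 hσp
  gcongr

theorem exists_ratioDistortionLE {F : ℝ → ℝ} {C p : ℝ} (hp : 0 ≤ p) (hF : ContDiff ℝ 1 F)
    (hadd : ∀ x, F (x + 1) = F x + 1) (hpos : ∀ x, 0 < deriv F x) (hC0 : 0 ≤ C)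
    (hC : ∀ x y, |deriv F x - deriv F y| ≤ C * |x - y| ^ p) :
    ∃ K, 0 ≤ K ∧ RatioDistortionLE F K p := by
  have hdiff : Differentiable ℝ F := hF.differentiable one_ne_zero
  obtain ⟨M, hM0, hM⟩ := exists_one_le_mul_of_periodic_of_pos (hF.continuous_deriv le_rfl)
    (periodic_deriv_of_map_add_one hadd) hpos
  refine ⟨C * M * 2 ^ p, by positivity, fun a b c hab hbc hle _ => ?_⟩
  obtain ⟨ξ, hξ, hξ'⟩ := exists_deriv_eq_slope F hab hdiff.continuous.continuousOn
    hdiff.differentiableOn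
  obtain ⟨ζ, hζ, hζ'⟩ := exists_deriv_eq_slope F hbc hdiff.continuous.continuousOn
    hdiff.differentiableOn
  have hba : 0 < b - a := sub_pos.2 hab
  have hcb : 0 < c - b := sub_pos.2 hbc
  rw [eq_div_iff hba.ne'] at hξ'
  rw [eq_div_iff hcb.ne'] at hζ'
  have hdist : |ζ - ξ| ≤ 2 * (b - a) := by
    rw [abs_of_pos (by linarith [hξ.2, hζ.1])]
    linarith [hξ.1, hζ.2]
  have hderiv : deriv F ζ ≤ deriv F ξ * Real.exp (C * M * 2 ^ p * (b - a) ^ p) := by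
    have := (hpos ξ).le
    calc deriv F ζ ≤ deriv F ξ + C * |ζ - ξ| ^ p := by
          linarith [le_abs_self (deriv F ζ - deriv F ξ), hC ζ ξ]
      _ ≤ deriv F ξ + C * (2 * (b - a)) ^ p * 1 := by rw [mul_one]; gcongr
      _ ≤ deriv F ξ + C * (2 * (b - a)) ^ p * (M * deriv F ξ) := by gcongr; exact hM ξ
      _ = deriv F ξ * (C * M * 2 ^ p * (b - a) ^ p + 1) := by
          rw [Real.mul_rpow zero_le_two hba.le]; ring
      _ ≤ _ := by gcongr; exact Real.add_one_le_exp _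
  rw [← hξ', ← hζ']
  calc deriv F ζ * (c - b) * (b - a)
      ≤ deriv F ξ * Real.exp (C * M * 2 ^ p * (b - a) ^ p) * (c - b) * (b - a) := by gcongr
    _ = (c - b) * (deriv F ξ * (b - a)) * Real.exp (C * M * 2 ^ p * (b - a) ^ p) := by ring

theorem deriv_pos_of_monotone_of_leftInverse_add {F G : ℝ → ℝ} {m : ℝ} (hmono : Monotone F)
    (hF : Differentiable ℝ F) (hG : Differentiable ℝ G) (h : ∀ x, G (F x) = x + m) (x : ℝ) :
    0 < deriv F x := by
  refine hmono.deriv_nonneg.lt_of_ne fun h0 => ?_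
  have hcomp : HasDerivAt (fun x => x + m) (deriv G (F x) * deriv F x) x :=
    ((hG (F x)).hasDerivAt.comp x (hF x).hasDerivAt).congr_of_eventuallyEq
      (Eventually.of_forall fun y => (h y).symm)
  simpa [← h0] using hcomp.unique ((hasDerivAt_id x).add_const m)

theorem IsCircleDiffeoOfClass.exists_lift {f : UnitAddCircle ≃ UnitAddCircle} {r : ℝ}
    (hf : IsCircleDiffeoOfClass r f) (hr : 1 < r) (hfix : ∀ x, f x ≠ x) :
    ∃ u : CircleDeg1Liftˣ, (∀ x : ℝ, ((u x : ℝ) : UnitAddCircle) = f x) ∧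
      ∃ K, 0 ≤ K ∧ RatioDistortionLE u K (min (r - 1) 1) := by
  obtain ⟨⟨F, hFl, hFd, hFC⟩, G, hGl, hGd, -⟩ := hf
  have hr1 : (1 : ℕ) ≤ ⌊r⌋₊ := Nat.le_floor (by exact_mod_cast hr.le)
  have hF : ContDiff ℝ 1 F := hFd.of_le (by exact_mod_cast hr1)
  have hG : ContDiff ℝ 1 G := hGd.of_le (by exact_mod_cast hr1)
  have hadd := lift_add_one_of_fixedPointFree hF.continuous hFl hfix
  obtain ⟨m, hm⟩ := exists_int_forall_eq_add_of_coe_eq (F := F ∘ G) (G := id)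
    (hF.continuous.comp hG.continuous) continuous_id fun x => by simp [hFl, hGl]
  obtain ⟨n, hn⟩ := exists_int_forall_eq_add_of_coe_eq (F := G ∘ F) (G := id)
    (hG.continuous.comp hF.continuous) continuous_id fun x => by simp [hFl, hGl]
  simp only [Function.comp_apply, id] at hm hn
  have hinj : Function.Injective F := fun x y hxy => by
    have := hn x
    rw [hxy, hn y] at this
    linarith
  have hsurj : Function.Surjective F := fun y => ⟨G (y - m), by rw [hm, sub_add_cancel]⟩
  have hmono : Monotone F := by
    refine ((hF.continuous.strictMono_of_inj hinj).resolve_right fun hanti => ?_).monotone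
    have := hanti (lt_add_one (0 : ℝ))
    rw [hadd] at this
    linarith
  have hpos := deriv_pos_of_monotone_of_leftInverse_add hmono (hF.differentiable one_ne_zero)
    (hG.differentiable one_ne_zero) hn
  obtain ⟨u, hu⟩ : IsUnit (⟨⟨F, hmono⟩, hadd⟩ : CircleDeg1Lift) :=
    isUnit_iff_bijective.2 ⟨hinj, hsurj⟩
  have huF : ⇑(u : CircleDeg1Lift) = F := by rw [hu]; rfl
  obtain ⟨C, hC0, hC⟩ := exists_holder_deriv hr hFd hadd hFC
  refine ⟨u, fun x => by rw [huF, hFl], ?_⟩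
  rw [huF]
  exact exists_ratioDistortionLE (le_min (by linarith) zero_le_one) hF hadd hpos hC0 hC

section LatticePaths

variable {ι : Type*} [DecidableEq ι]

/-- `LatticePathCost cost v s` means that some monotone lattice path from `0` to `v`, adding one
basis vector at each step, has total cost `s`: the sum of the values of `cost` at the points of the
path other than its endpoint `v`. -/
inductive LatticePathCost (cost : (ι → ℕ) → ℝ) : (ι → ℕ) → ℝ → Prop
  | zero : LatticePathCost cost 0 0
  | step {v : ι → ℕ} {s : ℝ} (i : ι) :
      LatticePathCost cost v s → LatticePathCost cost (v + Pi.single i 1) (s + cost v)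

theorem LatticePathCost.add_single {cost : (ι → ℕ) → ℝ} {v : ι → ℕ} {s : ℝ}
    (h : LatticePathCost cost v s) (i : ι) (m : ℕ) :
    LatticePathCost cost (v + Pi.single i m)
      (s + ∑ k ∈ Finset.range m, cost (v + Pi.single i k)) := by
  induction m with
  | zero => simpa using h
  | succ m ih =>
    rw [Finset.sum_range_succ, ← add_assoc, Pi.single_add, ← add_assoc]
    exact ih.step i

theorem sub_single_add_single {w : ι → ℕ} {i : ι} (hi : w i ≠ 0) :
    w - Pi.single i 1 + Pi.single i 1 = w := by
  ext j
  rcases eq_or_ne j i with rfl | hj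
  · simpa using Nat.sub_add_cancel (Nat.one_le_iff_ne_zero.2 hi)
  · simp [hj]

variable [Fintype ι]

/-- The expected total cost of the lattice path drawn by the Pólya urn process, given that it is at
`w` at time `n`. The urn moves from `v` in direction `i` with probability proportional to `v i + 1`,
is uniformly distributed on the points of coordinate sum `n` at time `n`, and hence was at
`w - Pi.single i 1` with conditional probability `w i / (n + 1)` just before being at `w`. -/
noncomputable def urnCost (cost : (ι → ℕ) → ℝ) : ℕ → (ι → ℕ) → ℝ
  | 0, _ => 0
  | n + 1, w => ∑ i, (w i : ℝ) / (n + 1) *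
      (urnCost cost n (w - Pi.single i 1) + cost (w - Pi.single i 1))

variable (ι) in
/-- The finite set of points of the lattice orthant `ι → ℕ` with coordinate sum `n`: the possible
positions of a monotone lattice path after `n` steps. -/
abbrev latticeLevel (n : ℕ) : Finset (ι → ℕ) := Finset.piAntidiag Finset.univ n

theorem mem_latticeLevel {n : ℕ} {v : ι → ℕ} : v ∈ latticeLevel ι n ↔ ∑ i, v i = n := by
  simp [latticeLevel]

theorem latticeLevel_nonempty [Nonempty ι] (n : ℕ) : (latticeLevel ι n).Nonempty :=
  ⟨Pi.single (Classical.arbitrary ι) n, by simp⟩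

theorem add_single_mem_latticeLevel_iff {n : ℕ} {v : ι → ℕ} {i : ι} :
    v + Pi.single i 1 ∈ latticeLevel ι (n + 1) ↔ v ∈ latticeLevel ι n := by
  simp [Finset.sum_add_distrib]

theorem exists_latticePathCost_le_urnCost (cost : (ι → ℕ) → ℝ) {n : ℕ} {w : ι → ℕ}
    (hw : w ∈ latticeLevel ι n) : ∃ s ≤ urnCost cost n w, LatticePathCost cost w s := by
  induction n generalizing w with
  | zero =>
    obtain rfl : w = 0 := by simpa using hw
    exact ⟨0, le_rfl, .zero⟩
  | succ n ih =>
    have hsum : ∑ i, (w i : ℝ) = n + 1 := by exact_mod_cast mem_latticeLevel.1 hw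
    set t := urnCost cost (n + 1) w with ht
    obtain ⟨i, hi, hle⟩ : ∃ i, w i ≠ 0 ∧
        urnCost cost n (w - Pi.single i 1) + cost (w - Pi.single i 1) ≤ t := by
      by_contra! hlt
      have hne : ∑ i, (w i : ℝ) ≠ 0 := by rw [hsum]; positivity
      obtain ⟨j, -, hj⟩ := Finset.exists_ne_zero_of_sum_ne_zero hne
      have : ∑ i, (w i : ℝ) / (n + 1) * t < t := by
        rw (occs := .pos [2]) [ht]
        refine Finset.sum_lt_sum (fun i _ => ?_) ⟨j, Finset.mem_univ j, ?_⟩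
        · rcases eq_or_ne (w i) 0 with h0 | h0
          · simp [h0]
          · exact mul_le_mul_of_nonneg_left (hlt i h0).le (by positivity)
        · have : (0 : ℝ) < w j := by positivity
          exact mul_lt_mul_of_pos_left (hlt j (by exact_mod_cast hj)) (by positivity)
      rw [← Finset.sum_mul, ← Finset.sum_div, hsum, div_self (by positivity), one_mul] at this
      exact lt_irrefl t this
    have hadd := sub_single_add_single hi
    obtain ⟨s, hs, hp⟩ := ih (add_single_mem_latticeLevel_iff.1 (hadd.symm ▸ hw))
    exact ⟨s + cost (w - Pi.single i 1), (by gcongr : _ ≤ _).trans hle, hadd ▸ hp.step i⟩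

theorem sum_latticeLevel_succ (n : ℕ) (g : (ι → ℕ) → ℝ) :
    ∑ w ∈ latticeLevel ι (n + 1), ∑ i, (w i : ℝ) * g (w - Pi.single i 1) =
      (n + Fintype.card ι) * ∑ v ∈ latticeLevel ι n, g v := by
  have hshift : ∀ i, ∑ w ∈ latticeLevel ι (n + 1), (w i : ℝ) * g (w - Pi.single i 1) =
      ∑ v ∈ latticeLevel ι n, ((v i : ℝ) + 1) * g v := by
    intro i
    symm
    refine Finset.sum_of_injOn (fun v => v + Pi.single i 1) (add_left_injective _).injOn
      (fun v hv => add_single_mem_latticeLevel_iff.2 hv) (fun w hw hni => ?_) (fun v _ => by simp)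
    have : w i = 0 := by
      by_contra h0
      have hadd := sub_single_add_single h0
      exact hni ⟨_, add_single_mem_latticeLevel_iff.1 (hadd.symm ▸ hw), hadd⟩
    simp [this]
  rw [Finset.sum_comm, Finset.sum_congr rfl fun i _ => hshift i, Finset.sum_comm, Finset.mul_sum]
  refine Finset.sum_congr rfl fun v hv => ?_
  rw [← Finset.sum_mul, Finset.sum_add_distrib, ← mem_latticeLevel.1 hv]
  simp

theorem card_latticeLevel_succ (n : ℕ) :
    (n + 1 : ℝ) * (latticeLevel ι (n + 1)).card =
      (n + Fintype.card ι) * (latticeLevel ι n).card := by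
  have hconst := sum_latticeLevel_succ (ι := ι) n fun _ => 1
  simp only [mul_one, Finset.sum_const, nsmul_eq_mul] at hconst
  rw [← hconst, mul_comm, ← nsmul_eq_mul, ← Finset.sum_const]
  exact Finset.sum_congr rfl fun w hw => by exact_mod_cast (mem_latticeLevel.1 hw).symm

theorem sum_urnCost_div_card [Nonempty ι] (cost : (ι → ℕ) → ℝ) (n : ℕ) :
    (∑ v ∈ latticeLevel ι n, urnCost cost n v) / (latticeLevel ι n).card =
      ∑ k ∈ Finset.range n, (∑ v ∈ latticeLevel ι k, cost v) / (latticeLevel ι k).card := by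
  induction n with
  | zero => simp [urnCost]
  | succ n ih =>
    have hstep : (n + 1 : ℝ) * ∑ w ∈ latticeLevel ι (n + 1), urnCost cost (n + 1) w =
        (n + Fintype.card ι) * ∑ v ∈ latticeLevel ι n, (urnCost cost n v + cost v) := by
      rw [← sum_latticeLevel_succ, Finset.mul_sum]
      refine Finset.sum_congr rfl fun w _ => ?_
      rw [urnCost, Finset.mul_sum]
      exact Finset.sum_congr rfl fun i _ => by field_simp
    have hn : (n + 1 : ℝ) ≠ 0 := by positivity
    rw [Finset.sum_range_succ, ← ih, ← add_div, ← Finset.sum_add_distrib,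
      ← mul_div_mul_left _ _ hn, hstep, card_latticeLevel_succ,
      mul_div_mul_left _ _ (by positivity)]

theorem card_latticeLevel (n : ℕ) :
    (latticeLevel ι n).card = (Fintype.card ι + n - 1).choose n := by
  rw [← Sym.card_sym_eq_choose, latticeLevel, ← Finset.map_sym_eq_piAntidiag, Finset.card_map,
    Finset.sym_univ, Finset.card_univ]

theorem pow_div_factorial_le_card_latticeLevel [Nonempty ι] (n : ℕ) :
    (n + 1 : ℝ) ^ (Fintype.card ι - 1) / (Fintype.card ι - 1).factorial ≤
      (latticeLevel ι n).card := by
  obtain ⟨d, hd⟩ := Nat.exists_eq_succ_of_ne_zero (Fintype.card_ne_zero (α := ι))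
  have hchoose := Nat.pow_le_choose (α := ℝ) d (d + n)
  rw [Nat.choose_symm_add, show d + n + 1 - d = n + 1 by omega, Nat.cast_add_one] at hchoose
  rwa [card_latticeLevel, hd, Nat.succ_sub_one, show d.succ + n - 1 = d + n by omega]

theorem summable_card_latticeLevel_rpow {σ : ℝ} (hσ0 : 0 < σ) (hσ1 : σ < 1)
    (hσ : 1 < Fintype.card ι * σ) :
    Summable fun n : ℕ => ((latticeLevel ι n).card : ℝ) ^ (-(σ / (1 - σ))) := by
  have : Nonempty ι := Fintype.card_pos_iff.1 <| Nat.pos_of_ne_zero fun h => by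
    norm_num [h] at hσ
  set d := Fintype.card ι - 1 with hd
  set q := σ / (1 - σ) with hq
  have hq0 : 0 < q := div_pos hσ0 (sub_pos.2 hσ1)
  have hdq : 1 < d * q := by
    have hcard : (Fintype.card ι : ℝ) = d + 1 := by
      exact_mod_cast (Nat.succ_pred_eq_of_pos Fintype.card_pos).symm
    rw [hcard] at hσ
    rw [hq, ← mul_div_assoc, one_lt_div (sub_pos.2 hσ1)]
    linarith
  have hsum : Summable fun n : ℕ => ((n + 1 : ℕ) : ℝ) ^ (-(d * q)) :=
    (summable_nat_add_iff 1).2 (Real.summable_nat_rpow.2 (neg_lt_neg hdq))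
  refine Summable.of_nonneg_of_le (fun n => by positivity) (fun n => ?_)
    (hsum.mul_left ((d.factorial : ℝ) ^ q))
  calc ((latticeLevel ι n).card : ℝ) ^ (-q)
      ≤ ((n + 1 : ℝ) ^ d / d.factorial) ^ (-q) :=
        Real.rpow_le_rpow_of_nonpos (by positivity) (pow_div_factorial_le_card_latticeLevel n)
          (neg_nonpos.2 hq0.le)
    _ = (d.factorial : ℝ) ^ q * ((n + 1 : ℕ) : ℝ) ^ (-(d * q)) := by
        rw [Real.div_rpow (by positivity) (by positivity), ← Real.rpow_natCast,
          ← Real.rpow_mul (by positivity), Real.rpow_neg (Nat.cast_nonneg _), div_inv_eq_mul,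
          mul_comm, mul_neg, Nat.cast_add_one]

theorem rpow_div_le {x N σ : ℝ} (hx : 0 ≤ x) (hN : 0 < N) (hσ : 0 ≤ σ) (hσ1 : σ < 1) :
    x ^ σ / N ≤ σ * x + (1 - σ) * (N ^ (-(σ / (1 - σ))) / N) := by
  have h1 : 1 - σ ≠ 0 := by linarith
  -- Weighted AM-GM for `x` and `N ^ (-1 / (1 - σ))`.
  have h := Real.geom_mean_le_arith_mean2_weighted hσ (by linarith : 0 ≤ 1 - σ) hx
    (Real.rpow_nonneg hN.le (-(1 / (1 - σ)))) (by ring)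
  rw [← Real.rpow_mul hN.le, neg_mul, one_div_mul_cancel h1, Real.rpow_neg_one,
    ← div_eq_mul_inv] at h
  rwa [← Real.rpow_sub_one hN.ne', show -(σ / (1 - σ)) - 1 = -(1 / (1 - σ)) by field_simp; ring]

theorem sum_rpow_div_card_le {α : Type*} {s : Finset α} (hs : s.Nonempty) {σ : ℝ} (hσ0 : 0 ≤ σ)
    (hσ1 : σ < 1) {l : α → ℝ} (hl0 : ∀ v, 0 ≤ l v) :
    (∑ v ∈ s, l v ^ σ) / s.card ≤
      σ * ∑ v ∈ s, l v + (1 - σ) * (s.card : ℝ) ^ (-(σ / (1 - σ))) := by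
  have hcard : (0 : ℝ) < s.card := by exact_mod_cast hs.card_pos
  rw [Finset.sum_div]
  refine (Finset.sum_le_sum fun v _ => rpow_div_le (hl0 v) hcard hσ0 hσ1).trans_eq ?_
  rw [Finset.sum_add_distrib, ← Finset.mul_sum, Finset.sum_const, nsmul_eq_mul]
  field_simp

theorem sum_range_sum_latticeLevel_le_tsum {l : (ι → ℕ) → ℝ} (hl0 : ∀ v, 0 ≤ l v)
    (hl : Summable l) (n : ℕ) :
    ∑ k ∈ Finset.range n, ∑ v ∈ latticeLevel ι k, l v ≤ ∑' v, l v := by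
  rw [← Finset.sum_biUnion]
  · exact hl.sum_le_tsum _ fun v _ => hl0 v
  · intro i _ j _ hij
    refine Finset.disjoint_left.2 fun v hi hj => hij ?_
    rw [← mem_latticeLevel.1 hi, ← mem_latticeLevel.1 hj]

theorem exists_latticePathCost_rpow_le {σ : ℝ} (hσ0 : 0 < σ) (hσ1 : σ < 1)
    (hσ : 1 < Fintype.card ι * σ) {l : (ι → ℕ) → ℝ} (hl0 : ∀ v, 0 ≤ l v) (hl : Summable l) :
    ∃ S, ∀ n, ∃ v ∈ latticeLevel ι n, ∃ s ≤ S, LatticePathCost (fun v => l v ^ σ) v s := by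
  have : Nonempty ι := Fintype.card_pos_iff.1 <| Nat.pos_of_ne_zero fun h => by
    norm_num [h] at hσ
  have hsum := summable_card_latticeLevel_rpow hσ0 hσ1 hσ
  set q := fun n : ℕ => ((latticeLevel ι n).card : ℝ) ^ (-(σ / (1 - σ)))
  refine ⟨σ * ∑' v, l v + (1 - σ) * ∑' n, q n, fun n => ?_⟩
  have hmean : (∑ v ∈ latticeLevel ι n, urnCost (fun v => l v ^ σ) n v) /
      (latticeLevel ι n).card ≤ σ * ∑' v, l v + (1 - σ) * ∑' n, q n := by
    rw [sum_urnCost_div_card]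
    refine (Finset.sum_le_sum fun k _ =>
      sum_rpow_div_card_le (latticeLevel_nonempty k) hσ0.le hσ1 hl0).trans ?_
    rw [Finset.sum_add_distrib, ← Finset.mul_sum, ← Finset.mul_sum]
    have : 0 ≤ 1 - σ := by linarith
    gcongr
    · exact sum_range_sum_latticeLevel_le_tsum hl0 hl n
    · exact hsum.sum_le_tsum _ fun k _ => by positivity
  have hne := latticeLevel_nonempty (ι := ι) n
  rw [div_le_iff₀ (by exact_mod_cast hne.card_pos), mul_comm, ← nsmul_eq_mul,
    ← Finset.sum_const] at hmean
  obtain ⟨v, hv, hle⟩ := Finset.exists_le_of_sum_le hne hmean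
  obtain ⟨s, hs, hp⟩ := exists_latticePathCost_le_urnCost _ hv
  exact ⟨v, hv, s, hs.trans hle, hp⟩

end LatticePaths

theorem exists_forall_exists_le_add_nsmul_mem {X : Type*} [AddGroup X] [TopologicalSpace X]
    [ContinuousAdd X] [CompactSpace X] {a : X} (ha : DenseRange fun k : ℕ => k • a) {U : Set X}
    (hU : IsOpen U) (hne : U.Nonempty) : ∃ N : ℕ, ∀ x, ∃ k ≤ N, x + k • a ∈ U := by
  have hcover : (univ : Set X) ⊆ ⋃ k : ℕ, (· + k • a) ⁻¹' U := fun x _ => by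
    obtain ⟨y, hy⟩ := hne
    obtain ⟨k, hk⟩ := ha.exists_mem_open (hU.preimage (continuous_const_add x))
      ⟨-x + y, by simpa using hy⟩
    exact mem_iUnion.2 ⟨k, hk⟩
  obtain ⟨T, hT⟩ := isCompact_univ.elim_finite_subcover _
    (fun k : ℕ => hU.preimage (continuous_add_const (k • a))) hcover
  refine ⟨T.sup id, fun x => ?_⟩
  obtain ⟨k, hk, hx⟩ := mem_iUnion₂.1 (hT (mem_univ x))
  exact ⟨k, Finset.le_sup (f := id) hk, hx⟩

theorem exists_forall_exists_le_add_mul_mem_Ioo {α : ℝ} (hα : Irrational α) {η : ℝ}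
    (hη : 0 < η) :
    ∃ N : ℕ, ∀ x : ℝ, ∃ k ≤ N, ∃ m : ℤ, x + k * α + m ∈ Ioo 0 η := by
  have hdense : DenseRange fun k : ℕ => k • (α : UnitAddCircle) := by
    rw [← denseRange_zsmul_iff_nsmul, AddCircle.denseRange_zsmul_coe_iff, div_one]
    exact hα
  obtain ⟨N, hN⟩ := exists_forall_exists_le_add_nsmul_mem hdense
    (QuotientAddGroup.isOpenMap_coe (Ioo 0 η) isOpen_Ioo) ((nonempty_Ioo.2 hη).image _)
  refine ⟨N, fun x => ?_⟩
  obtain ⟨k, hk, y, hy, hyx⟩ := hN x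
  obtain ⟨m, rfl⟩ := unitAddCircle_coe_eq_coe_iff (x := y) (y := x + k * α).1 (by
    simpa using hyx)
  exact ⟨k, hk, m, hy⟩

theorem irrational_of_injective_coe {M : Type*} [AddMonoid M] [IsAddTorsionFree M] {t : M →+ ℝ}
    (ht : Function.Injective fun v => (t v : UnitAddCircle)) {v : M} (hv : v ≠ 0) :
    Irrational (t v) := by
  rintro ⟨q, hq⟩
  refine hv (nsmul_right_injective q.den_nz (ht ?_))
  have hint : t (q.den • v) = q.num := by
    rw [map_nsmul, nsmul_eq_mul, ← hq]
    exact_mod_cast Rat.den_mul_eq_num q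
  simp [hint]

section Semiconjugacy

variable {h : CircleDeg1Lift}

theorem semiconj_pow {u : CircleDeg1Lift} {t : ℝ} (hu : ∀ x, h (u x) = h x + t) (k : ℕ) (x : ℝ) :
    h ((u ^ k) x) = h x + k * t := by
  induction k with
  | zero => simp
  | succ k ih =>
    rw [pow_succ', mul_apply, hu, ih]
    push_cast
    ring

theorem exists_pow_add_int_mem_Ioo {u : CircleDeg1Lift} {t : ℝ} (ht : Irrational t)
    (hu : ∀ x, h (u x) = h x + t) (x : ℝ) {p q : ℝ} (hpq : p < q) :
    ∃ (k : ℕ) (m : ℤ), h ((u ^ k) x + m) ∈ Ioo p q := by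
  obtain ⟨N, hN⟩ := exists_forall_exists_le_add_mul_mem_Ioo ht (sub_pos.2 hpq)
  obtain ⟨k, -, m, hm⟩ := hN (h x - p)
  refine ⟨k, m, ?_⟩
  rw [map_add_int, semiconj_pow hu]
  constructor <;> linarith [hm.1, hm.2]

theorem continuous_of_semiconj_irrational {u : CircleDeg1Lift} {t : ℝ} (ht : Irrational t)
    (hu : ∀ x, h (u x) = h x + t) : Continuous h :=
  h.monotone.continuous_of_denseRange <| dense_iff_exists_between.2 fun _ _ hpq =>
    let ⟨k, m, hkm⟩ := exists_pow_add_int_mem_Ioo ht hu 0 hpq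
    ⟨_, ⟨(u ^ k) 0 + m, rfl⟩, hkm⟩

theorem denseRange_pow_add_int_of_semiconj_irrational (hinj : StrictMono h) {u : CircleDeg1Lift}
    {t : ℝ} (ht : Irrational t) (hu : ∀ x, h (u x) = h x + t) (x : ℝ) :
    DenseRange fun p : ℕ × ℤ => (u ^ p.1) x + p.2 :=
  dense_iff_exists_between.2 fun _ _ hpq =>
    let ⟨k, m, hkm⟩ := exists_pow_add_int_mem_Ioo ht hu x (hinj hpq)
    ⟨_, ⟨(k, m), rfl⟩, hinj.lt_iff_lt.1 hkm.1, hinj.lt_iff_lt.1 hkm.2⟩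

theorem le_add_one_of_map_eq {a b : ℝ} (hab : h a = h b) : b ≤ a + 1 := by
  by_contra! hlt
  have := h.monotone hlt.le
  rw [map_add_one] at this
  linarith

theorem exists_isGreatest_fiber_of_not_strictMono (hcont : Continuous h) (hns : ¬ StrictMono h) :
    ∃ a b, a < b ∧ IsGreatest {x | h x = h a} b := by
  obtain ⟨a, c, hac, hca⟩ : ∃ a c, a < c ∧ h c ≤ h a := by simpa [StrictMono] using hns
  have hbdd : BddAbove {x | h x = h a} :=
    ⟨a + 1, fun x (hx : h x = h a) => le_add_one_of_map_eq hx.symm⟩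
  have hclosed : IsClosed {x | h x = h a} := isClosed_eq hcont continuous_const
  refine ⟨a, sSup {x | h x = h a}, hac.trans_le ?_, hclosed.isGreatest_csSup ⟨a, rfl⟩ hbdd⟩
  exact le_csSup hbdd (hca.antisymm (h.monotone hac.le))

theorem summable_sub_of_map_eq {κ : Type*} {u : κ → CircleDeg1Lift} {t : κ → ℝ}
    (hu : ∀ i x, h (u i x) = h x + t i) (ht : Function.Injective fun i => (t i : UnitAddCircle))
    {a b : ℝ} (hab : a ≤ b) (heq : h a = h b) : Summable fun i => u i b - u i a := by
  have hle : ∀ i, u i a ≤ u i b := fun i => (u i).monotone hab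
  -- The images of `Ioo a b` are translated so that their left endpoints lie in `Ico 0 1`.
  set J : κ → Set ℝ := fun i => Ioo (u i a - ⌊u i a⌋) (u i b - ⌊u i a⌋) with hJ
  have hvol : ∀ i, MeasureTheory.volume.real (J i) = u i b - u i a := fun i => by
    rw [hJ, Real.volume_real_Ioo_of_le (by linarith [hle i]), sub_sub_sub_cancel_right]
  have hsub : ∀ i, J i ⊆ Ioo 0 2 := fun i => by
    have hb := (u i).monotone (le_add_one_of_map_eq heq)
    rw [map_add_one] at hb
    exact Ioo_subset_Ioo (by linarith [Int.floor_le (u i a)])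
      (by linarith [Int.lt_floor_add_one (u i a)])
  have hval : ∀ i, ∀ z ∈ J i, h z = h a + t i - ⌊u i a⌋ := fun i z hz => by
    have hlo := h.monotone hz.1.le
    have hhi := h.monotone hz.2.le
    rw [map_sub_int, hu] at hlo hhi
    linarith
  have hdisj : Pairwise (Function.onFun Disjoint J) := fun i j hij => by
    refine disjoint_left.2 fun z hi hj => hij (ht ?_)
    refine unitAddCircle_coe_eq_coe_iff.2 ⟨⌊u i a⌋ - ⌊u j a⌋, ?_⟩
    push_cast
    linarith [hval i z hi, hval j z hj]
  refine summable_of_sum_le (c := 2) (fun i => sub_nonneg.2 (hle i)) fun s => ?_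
  calc ∑ i ∈ s, (u i b - u i a) = MeasureTheory.volume.real (⋃ i ∈ s, J i) := by
        rw [MeasureTheory.measureReal_biUnion_finset (hdisj.set_pairwise s)
          (fun i _ => measurableSet_Ioo) fun i _ => measure_Ioo_lt_top.ne]
        exact Finset.sum_congr rfl fun i _ => (hvol i).symm
    _ ≤ MeasureTheory.volume.real (Ioo (0 : ℝ) 2) :=
        MeasureTheory.measureReal_mono (iUnion₂_subset fun i _ => hsub i) (by simp)
    _ = 2 := by rw [Real.volume_real_Ioo_of_le zero_le_two, sub_zero]

end Semiconjugacy

theorem exists_forall_le_sum_of_eventually_cofinite {ι : Type*} [Fintype ι] {p : (ι → ℕ) → Prop}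
    (hp : ∀ᶠ w in cofinite, p w) : ∃ n, ∀ w, n ≤ ∑ i, w i → p w := by
  obtain ⟨n, hn⟩ := ((eventually_cofinite.1 hp).image fun w => ∑ i, w i).bddAbove
  refine ⟨n + 1, fun w hw => ?_⟩
  by_contra hpw
  exact (hn ⟨w, hpw, rfl⟩).not_gt hw

theorem le_of_mul_le_mul_exp {x y p q K s S : ℝ} (hy : 0 ≤ y) (hp : 0 < p) (hq : 0 ≤ q)
    (hK : 0 ≤ K) (hs : s ≤ S) (hS : q * Real.exp (K * S) ≤ p)
    (h : x * p ≤ q * y * Real.exp (K * s)) : x ≤ y := by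
  refine le_of_mul_le_mul_right ?_ hp
  calc x * p ≤ q * y * Real.exp (K * s) := h
    _ ≤ q * y * Real.exp (K * S) := by gcongr
    _ = y * (q * Real.exp (K * S)) := by ring
    _ ≤ y * p := by gcongr

section Distortion

variable {ι : Type*} [DecidableEq ι]

theorem LatticePathCost.ratio_le {E : (ι → ℕ) → ℝ → ℝ} {f : ι → ℝ → ℝ} {K σ : ℝ}
    (hmono : ∀ v, StrictMono (E v)) (hzero : ∀ x, E 0 x = x)
    (hstep : ∀ v i x, E (v + Pi.single i 1) x = f i (E v x))
    (hdist : ∀ i, RatioDistortionLE (f i) K σ) (hK : 0 ≤ K) {a b c S : ℝ} (hab : a < b)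
    (hbc : b < c) (hlen : ∀ v, E v b - E v a ≤ 1) (hS : (c - b) * Real.exp (K * S) ≤ b - a)
    {v : ι → ℕ} {s : ℝ} (hp : LatticePathCost (fun v => (E v b - E v a) ^ σ) v s) (hs : s ≤ S) :
    (E v c - E v b) * (b - a) ≤ (c - b) * (E v b - E v a) * Real.exp (K * s) ∧
      E v c - E v b ≤ E v b - E v a := by
  have hba : 0 < b - a := sub_pos.2 hab
  have hcb : 0 < c - b := sub_pos.2 hbc
  have hlpos : ∀ v, 0 < E v b - E v a := fun v => sub_pos.2 (hmono v hab)
  have hle_of {v : ι → ℕ} {s : ℝ} (hs : s ≤ S) :=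
    le_of_mul_le_mul_exp (x := E v c - E v b) (hlpos v).le hba hcb.le hK hs hS
  suffices hr : (E v c - E v b) * (b - a) ≤ (c - b) * (E v b - E v a) * Real.exp (K * s) from
    ⟨hr, hle_of hs hr⟩
  induction hp with
  | zero => simp [hzero]
  | @step v s i _ ih =>
    set r := (E v b - E v a) ^ σ
    have hr0 : 0 ≤ r := Real.rpow_nonneg (hlpos v).le _
    have hsS : s ≤ S := by linarith
    have hi := hdist i (hmono v hab) (hmono v hbc) (hle_of hsS (ih hsS)) (hlen v)
    simp only [← hstep] at hi
    have := hlpos (v + Pi.single i 1)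
    refine le_of_mul_le_mul_right ?_ (hlpos v)
    rw [mul_add, Real.exp_add]
    set v' := v + Pi.single i 1
    calc (E v' c - E v' b) * (b - a) * (E v b - E v a)
        = (E v' c - E v' b) * (E v b - E v a) * (b - a) := by ring
      _ ≤ (E v c - E v b) * (E v' b - E v' a) * Real.exp (K * r) * (b - a) := by gcongr
      _ = (E v c - E v b) * (b - a) * ((E v' b - E v' a) * Real.exp (K * r)) := by ring
      _ ≤ (c - b) * (E v b - E v a) * Real.exp (K * s) *
          ((E v' b - E v' a) * Real.exp (K * r)) :=
        mul_le_mul_of_nonneg_right (ih hsS) (by positivity)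
      _ = _ := by ring

variable [Fintype ι]

theorem exists_prolongable_latticePathCost {σ : ℝ} (hσ0 : 0 < σ) (hσ1 : σ < 1)
    (hσ : 1 < Fintype.card ι * σ) {l : (ι → ℕ) → ℝ} (hl0 : ∀ v, 0 ≤ l v) (hl : Summable l)
    (i : ι) : ∃ S, ∀ ε > 0, ∀ N : ℕ, ∃ v : ι → ℕ, ∀ k ≤ N, l (v + Pi.single i k) < ε ∧
      ∃ s ≤ S, LatticePathCost (fun v => l v ^ σ) (v + Pi.single i k) s := by
  obtain ⟨S, hS⟩ := exists_latticePathCost_rpow_le hσ0 hσ1 hσ hl0 hl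
  refine ⟨S + 1, fun ε hε N => ?_⟩
  have hlim : Tendsto (fun w => l w ^ σ) cofinite (𝓝 0) := by
    simpa [Real.zero_rpow hσ0.ne'] using
      hl.tendsto_cofinite_zero.rpow_const (p := σ) (Or.inr hσ0.le)
  obtain ⟨n, hn⟩ := exists_forall_le_sum_of_eventually_cofinite
    ((hl.tendsto_cofinite_zero.eventually_lt_const hε).and
      (hlim.eventually_le_const (by positivity : (0 : ℝ) < 1 / (N + 1))))
  obtain ⟨v, hv, s, hs, hp⟩ := hS n
  have hlevel : ∀ k, n ≤ ∑ j, (v + Pi.single i k : ι → ℕ) j := fun k => by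
    simp [Finset.sum_add_distrib, mem_latticeLevel.1 hv]
  refine ⟨v, fun k hk => ⟨(hn _ (hlevel k)).1, _, ?_, hp.add_single i k⟩⟩
  have hsum : ∑ j ∈ Finset.range k, l (v + Pi.single i j) ^ σ ≤ 1 :=
    calc _ ≤ k • (1 / (N + 1 : ℝ)) := by
          simpa using Finset.sum_le_card_nsmul (Finset.range k) _ _
            fun j _ => (hn _ (hlevel j)).2
      _ ≤ 1 := by
        rw [nsmul_eq_mul, mul_one_div, div_le_one (by positivity)]
        exact_mod_cast hk.trans N.le_succ
  linarith

section LiftFamily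

variable {h : CircleDeg1Lift} {E : (ι → ℕ) → CircleDeg1Lift} {f : ι → CircleDeg1Lift}
  {t : (ι → ℕ) →+ ℝ} {K σ : ℝ}

theorem exists_forall_exists_sub_lt_of_ratioDistortionLE (hmono : ∀ v, StrictMono (E v))
    (hzero : E 0 = 1) (hstep : ∀ v i, E (v + Pi.single i 1) = f i * E v)
    (hsemi : ∀ v x, h (E v x) = h x + t v)
    (ht : Function.Injective fun v => (t v : UnitAddCircle))
    (hdist : ∀ i, RatioDistortionLE (f i) K σ) (hK : 0 ≤ K) (hσ0 : 0 < σ) (hσ1 : σ < 1)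
    (hσ : 1 < Fintype.card ι * σ) {a b : ℝ} (hab : a < b) (heq : h a = h b) (i : ι) :
    ∃ δ > 0, ∀ ε > 0, ∀ N : ℕ, ∃ v : ι → ℕ, ∀ k ≤ N,
      E (v + Pi.single i k) (b + δ) - E (v + Pi.single i k) b < ε := by
  have hlen : ∀ v, E v b - E v a ≤ 1 := fun v => by
    have := (E v).monotone (le_add_one_of_map_eq heq)
    rw [map_add_one] at this
    linarith
  obtain ⟨S, hS⟩ := exists_prolongable_latticePathCost hσ0 hσ1 hσ
    (fun v => sub_nonneg.2 ((E v).monotone hab.le))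
    (summable_sub_of_map_eq hsemi ht hab.le heq) i
  set δ := (b - a) * Real.exp (-(K * S)) with hδ
  have hδ0 : 0 < δ := mul_pos (sub_pos.2 hab) (Real.exp_pos _)
  have hδS : (b + δ - b) * Real.exp (K * S) ≤ b - a := by
    rw [add_sub_cancel_left, hδ, mul_assoc, ← Real.exp_add, neg_add_cancel, Real.exp_zero, mul_one]
  refine ⟨δ, hδ0, fun ε hε N => ?_⟩
  obtain ⟨v, hv⟩ := hS ε hε N
  refine ⟨v, fun k hk => ?_⟩
  obtain ⟨hsmall, s, hs, hp⟩ := hv k hk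
  exact (hp.ratio_le (E := fun v => E v) (f := fun i => f i) hmono (by simp [hzero])
    (by simp [hstep]) hdist hK hab (by linarith) hlen hδS hs).2.trans_lt hsmall

theorem strictMono_of_semiconj_of_ratioDistortionLE (hmono : ∀ v, StrictMono (E v))
    (hzero : E 0 = 1) (hstep : ∀ v i, E (v + Pi.single i 1) = f i * E v)
    (hsemi : ∀ v x, h (E v x) = h x + t v)
    (ht : Function.Injective fun v => (t v : UnitAddCircle))
    (hdist : ∀ i, RatioDistortionLE (f i) K σ) (hK : 0 ≤ K) (hσ0 : 0 < σ) (hσ1 : σ < 1)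
    (hσ : 1 < Fintype.card ι * σ) : StrictMono h := by
  obtain ⟨i⟩ : Nonempty ι := Fintype.card_pos_iff.1 <| Nat.pos_of_ne_zero fun h0 => by
    norm_num [h0] at hσ
  have hirr : Irrational (t (Pi.single i 1)) :=
    irrational_of_injective_coe ht (by simp)
  have hcont := continuous_of_semiconj_irrational hirr (hsemi (Pi.single i 1))
  by_contra hns
  obtain ⟨a, b, hab, hba, hbmax⟩ := exists_isGreatest_fiber_of_not_strictMono hcont hns
  obtain ⟨δ, hδ0, hδ⟩ := exists_forall_exists_sub_lt_of_ratioDistortionLE hmono hzero hstep hsemi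
    ht hdist hK hσ0 hσ1 hσ hab hba.symm i
  have hgap : h b < h (b + δ / 2) :=
    (h.monotone (by linarith)).lt_of_ne fun heq => by
      linarith [hbmax (heq.symm.trans hba : h (b + δ / 2) = h a)]
  -- A return time along the axis `i` brings the image of `b` just to the right of `b`.
  obtain ⟨N, hN⟩ := exists_forall_exists_le_add_mul_mem_Ioo hirr (sub_pos.2 hgap)
  obtain ⟨v, hv⟩ := hδ (δ / 2) (half_pos hδ0) N
  obtain ⟨k, hkN, m, hm0, hm1⟩ := hN (t v)
  have hsmall := hv k hkN
  set w := v + Pi.single i k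
  have htw : t w = t v + k * t (Pi.single i 1) := by
    rw [map_add, ← nsmul_eq_mul, ← map_nsmul, ← Pi.single_smul, smul_eq_mul, mul_one]
  rw [← htw] at hm0 hm1
  have hret : ∀ x, h (E w x + m) = h x + (t w + m) := fun x => by
    rw [map_add_int, hsemi, add_assoc]
  have hb : E w b + m < b + δ / 2 := h.monotone.reflect_lt (by rw [hret]; linarith)
  -- So `b + δ` does not move to the right, although its `h`-value increases by `t w + m > 0`.
  have := h.monotone (by linarith : E w (b + δ) + m ≤ b + δ)
  rw [hret] at this
  linarith

end LiftFamily

end Distortion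

theorem continuous_coe_unit (u : CircleDeg1Liftˣ) : Continuous u := by
  rw [← coe_toOrderIso]
  exact (toOrderIso u).continuous

theorem strictMono_coe_unit (u : CircleDeg1Liftˣ) : StrictMono u := by
  rw [← coe_toOrderIso]
  exact (toOrderIso u).strictMono

section CommutingLifts

variable {A : Type*} [CommGroup A]

/-- The translation number as a homomorphism on an abelian group acting by lifts of circle
homeomorphisms. It is only a quasimorphism on the group of all lifts. -/
noncomputable def translationNumberHom (ρ : A →* CircleDeg1Liftˣ) : A →* Multiplicative ℝ where
  toFun a := Multiplicative.ofAdd (translationNumber (ρ a))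
  map_one' := by simp
  map_mul' a b := by
    rw [map_mul, Units.val_mul, ← ofAdd_add, translationNumber_mul_of_commute]
    exact ((Commute.all a b).map ρ).map (Units.coeHom _)

theorem exists_semiconj_translationNumber (ρ : A →* CircleDeg1Liftˣ) :
    ∃ h : CircleDeg1Lift, ∀ a x, h (ρ a x) = h x + translationNumber (ρ a) := by
  obtain ⟨h, hh⟩ := semiconj_of_group_action_of_forall_translationNumber_eq
    ((Units.coeHom _).comp ρ) ((Units.coeHom _).comp (translate.comp (translationNumberHom ρ)))
    fun a => (translationNumber_translate _).symm
  exact ⟨h, fun a x => (hh a x).trans ((translate_apply _ _).trans (add_comm _ _))⟩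

variable {ι : Type*} [Fintype ι]

/-- The translation number of the monomial `∏ i, a i ^ v i` as an additive function of its exponent
vector `v`. -/
noncomputable def monomialTranslationNumber (ρ : A →* CircleDeg1Liftˣ) (a : ι → A) :
    (ι → ℕ) →+ ℝ where
  toFun v := translationNumber (ρ (∏ i, a i ^ v i))
  map_zero' := by simp
  map_add' v w := by
    simp only [Pi.add_apply, pow_add, Finset.prod_mul_distrib]
    exact congrArg Multiplicative.toAdd (map_mul (translationNumberHom ρ) _ _)

theorem strictMono_of_semiconj_translationNumber {ρ : A →* CircleDeg1Liftˣ} {a : ι → A}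
    {h : CircleDeg1Lift} {K σ : ℝ} (hsemi : ∀ a x, h (ρ a x) = h x + translationNumber (ρ a))
    (ht : Function.Injective fun v => (monomialTranslationNumber ρ a v : UnitAddCircle))
    (hdist : ∀ i, RatioDistortionLE (ρ (a i)) K σ) (hK : 0 ≤ K) (hσ0 : 0 < σ) (hσ1 : σ < 1)
    (hσ : 1 < Fintype.card ι * σ) : StrictMono h := by
  classical
  refine strictMono_of_semiconj_of_ratioDistortionLE (E := fun v => ρ (∏ i, a i ^ v i))
    (fun v => strictMono_coe_unit _) (by simp) (fun v i => ?_) (fun v => hsemi _)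
    ht hdist hK hσ0 hσ1 hσ
  rw [← Units.val_mul, ← map_mul, mul_comm]
  simp only [Pi.add_apply, Pi.single_apply, pow_add, Finset.prod_mul_distrib,
    pow_ite, pow_one, pow_zero, Fintype.prod_ite_eq']

end CommutingLifts

section ActionLifts

variable {Γ : Type*} [AddCommGroup Γ] [AddAction Γ UnitAddCircle]

/-- `IsLiftOf n u` means that the homeomorphism `u` of the line is a lift of the action of `n` on
the circle. -/
def IsLiftOf (n : Γ) (u : CircleDeg1Liftˣ) : Prop :=
  ∀ x : ℝ, ((u x : ℝ) : UnitAddCircle) = n +ᵥ (x : UnitAddCircle)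

namespace IsLiftOf

variable {n m : Γ} {u v : CircleDeg1Liftˣ}

theorem mul (hu : IsLiftOf n u) (hv : IsLiftOf m v) : IsLiftOf (n + m) (u * v) := fun x => by
  rw [Units.val_mul, mul_apply, hu, hv, add_vadd]

theorem one : IsLiftOf (0 : Γ) 1 := fun x => by simp

theorem inv (hu : IsLiftOf n u) : IsLiftOf (-n) u⁻¹ := fun x => by
  rw [eq_neg_vadd_iff, ← hu, units_apply_inv_apply]

theorem pow (hu : IsLiftOf n u) (k : ℕ) : IsLiftOf (k • n) (u ^ k) := by
  induction k with
  | zero => simpa using one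
  | succ k ih =>
    rw [pow_succ, succ_nsmul]
    exact ih.mul hu

theorem eq_zero_of_translationNumber_eq (hfree : IsFreeAddAction Γ UnitAddCircle)
    (hu : IsLiftOf n u) {k : ℤ} (h : translationNumber u = k) : n = 0 := by
  obtain ⟨x, hx⟩ := (translationNumber_eq_int_iff _ (continuous_coe_unit u)).1 h
  refine hfree n x ?_
  rw [← hu, unitAddCircle_coe_eq_coe_iff]
  exact ⟨k, hx⟩

theorem exists_eq_translate_mul (hu : IsLiftOf n u) (hv : IsLiftOf n v) :
    ∃ k : ℤ, u = translate (Multiplicative.ofAdd (k : ℝ)) * v := by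
  obtain ⟨k, hk⟩ := exists_int_forall_eq_add_of_coe_eq (continuous_coe_unit u)
    (continuous_coe_unit v) fun x => by rw [hu, hv]
  refine ⟨k, ?_⟩
  ext x
  rw [hk, Units.val_mul, mul_apply, translate_apply, add_comm]

theorem commute (hu : IsLiftOf n u) (hv : IsLiftOf m v) : Commute u v := by
  have hconj : IsLiftOf m (u * v * u⁻¹) := by simpa using (hu.mul hv).mul hu.inv
  obtain ⟨k, hk⟩ := hconj.exists_eq_translate_mul hv
  have hcomm : Commute (translate (Multiplicative.ofAdd (k : ℝ)) : CircleDeg1Lift) v :=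
    commute_iff_commute.2 fun x => by simp
  -- The translation number is invariant under conjugation, which forces `k = 0`.
  have h := congrArg (fun w : CircleDeg1Liftˣ => translationNumber w) hk
  simp only [Units.val_mul, translationNumber_conj_eq, translationNumber_mul_of_commute hcomm,
    translationNumber_translate] at h
  have hk0 : (k : ℝ) = 0 := by linarith
  rw [hk0, ofAdd_zero, map_one, one_mul] at hk
  exact mul_inv_eq_iff_eq_mul.1 hk

theorem isMinimal_of_strictMono_semiconj (hu : IsLiftOf n u) {h : CircleDeg1Lift}
    (hinj : StrictMono h) {t : ℝ} (ht : Irrational t) (hsemi : ∀ x, h (u x) = h x + t) :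
    AddAction.IsMinimal Γ UnitAddCircle := by
  refine ⟨fun x => ?_⟩
  induction x using QuotientAddGroup.induction_on with | H x => ?_
  refine (QuotientAddGroup.mk_surjective.denseRange.comp
    (denseRange_pow_add_int_of_semiconj_irrational hinj ht hsemi x)
    (AddCircle.continuous_mk' 1)).mono ?_
  rintro _ ⟨⟨k, m⟩, rfl⟩
  refine ⟨k • n, ?_⟩
  change k • n +ᵥ (x : UnitAddCircle) = (((u : CircleDeg1Lift) ^ k) x + m : ℝ)
  rw [← hu.pow k, unitAddCircle_coe_eq_coe_iff]
  exact ⟨-m, by simp⟩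

end IsLiftOf

variable (Γ) in
/-- The group of pairs `(u, n)` with `u` a lift of the action of `n`: the pullback of the action
along the covering of the circle by the line. -/
def liftGroup : Subgroup (CircleDeg1Liftˣ × Multiplicative Γ) where
  carrier := {p | IsLiftOf p.2.toAdd p.1}
  mul_mem' hp hq := hp.mul hq
  one_mem' := .one
  inv_mem' hp := hp.inv

instance : CommGroup (liftGroup Γ) where
  mul_comm p q := Subtype.ext <| Prod.ext (p.2.commute q.2) (mul_comm _ _)

variable (Γ) in
/-- The projection of `liftGroup Γ` to the homeomorphisms of the line. -/
def liftGroupHom : liftGroup Γ →* CircleDeg1Liftˣ :=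
  (MonoidHom.fst _ _).comp (liftGroup Γ).subtype

theorem injective_coe_monomialTranslationNumber (hfree : IsFreeAddAction Γ UnitAddCircle)
    {ι : Type*} [Fintype ι] {a : ι → liftGroup Γ}
    (ha : LinearIndependent ℤ fun i => (a i).1.2.toAdd) :
    Function.Injective fun v =>
      (monomialTranslationNumber (liftGroupHom Γ) a v : UnitAddCircle) := by
  intro v w hvw
  obtain ⟨k, hk⟩ := unitAddCircle_coe_eq_coe_iff.1 hvw
  let π : liftGroup Γ →* Multiplicative Γ := (MonoidHom.snd _ _).comp (liftGroup Γ).subtype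
  have hπ (v : ι → ℕ) : (π (∏ i, a i ^ v i)).toAdd = ∑ i, v i • (a i).1.2.toAdd := by
    simp only [map_prod, map_pow, toAdd_prod, toAdd_pow]
    rfl
  set p := ∏ i, a i ^ v i
  set q := ∏ i, a i ^ w i
  have hpq : translationNumber (liftGroupHom Γ (p / q)) = k := by
    have := congrArg Multiplicative.toAdd (map_div (translationNumberHom (liftGroupHom Γ)) p q)
    exact this.trans (sub_eq_of_eq_add' hk)
  have hzero : (π (p / q)).toAdd = 0 := (p / q).2.eq_zero_of_translationNumber_eq hfree hpq
  rw [map_div, toAdd_div, sub_eq_zero] at hzero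
  refine funext (Fintype.linearIndependent_iffₛ.1 (ha.restrict_scalars' ℕ) v w ?_)
  rw [← hπ, ← hπ, hzero]

end ActionLifts

theorem mainTheorem1_general {ι Γ : Type*} [Fintype ι] [AddCommGroup Γ]
    [AddAction Γ UnitAddCircle] {r : ℝ} (hι : 2 ≤ Fintype.card ι)
    (hr : 1 + 1 / (Fintype.card ι : ℝ) < r) (hfree : IsFreeAddAction Γ UnitAddCircle) {g : ι → Γ}
    (hg : LinearIndependent ℤ g) (hclass : ∀ i, IsCircleDiffeoOfClass r (AddAction.toPerm (g i))) :
    AddAction.IsMinimal Γ UnitAddCircle := by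
  have hd : (2 : ℝ) ≤ Fintype.card ι := by exact_mod_cast hι
  have hr1 : 1 < r := lt_trans (lt_add_of_pos_right 1 (by positivity)) hr
  choose u hu K hK hdist using fun i => (hclass i).exists_lift hr1 fun x hx =>
    hg.ne_zero i (hfree _ x hx)
  obtain ⟨h, hsemi⟩ := exists_semiconj_translationNumber (liftGroupHom Γ)
  let a : ι → liftGroup Γ := fun i => ⟨(u i, Multiplicative.ofAdd (g i)), hu i⟩
  have ht := injective_coe_monomialTranslationNumber hfree (a := a) hg
  obtain ⟨σ, hσlo, hσhi⟩ : ∃ σ, 1 / (Fintype.card ι : ℝ) < σ ∧ σ < min (r - 1) 1 :=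
    exists_between (lt_min (by linarith) ((div_lt_one (by linarith)).2 (by linarith)))
  have hmono : StrictMono h := strictMono_of_semiconj_translationNumber hsemi ht
    (fun i => (hdist i).mono (u i).val.monotone (hK i)
      (Finset.single_le_sum (fun j _ => hK j) (Finset.mem_univ i)) hσhi.le)
    (Finset.sum_nonneg fun i _ => hK i) (lt_of_le_of_lt (by positivity) hσlo)
    (hσhi.trans_le (min_le_right _ _)) ((div_lt_iff₀' (by linarith)).1 hσlo)
  obtain ⟨i⟩ : Nonempty ι := Fintype.card_pos_iff.1 (by omega)
  classical
  exact (∏ j, a j ^ (Pi.single i 1 : ι → ℕ) j).2.isMinimal_of_strictMono_semiconj hmono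
    (irrational_of_injective_coe ht (v := Pi.single i 1) (by simp)) (hsemi _)

theorem mainTheorem1 (d : ℕ) (hd : 2 ≤ d) (ε : ℝ) (hε : 0 < ε)
    [AddAction (Fin d → ℤ) UnitAddCircle]
    (hfree : IsFreeAddAction (Fin d → ℤ) UnitAddCircle)
    (hclass : ∀ n : Fin d → ℤ,
      IsCircleDiffeoOfClass (1 + 1 / (d : ℝ) + ε)
        (AddAction.toPerm n : UnitAddCircle ≃ UnitAddCircle)) :
    AddAction.IsMinimal (Fin d → ℤ) UnitAddCircle :=
  mainTheorem1_general (by simpa using hd) (by simpa using hε) hfree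
    (Pi.basisFun ℤ (Fin d)).linearIndependent fun _ => hclass _
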